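/- Theorem 5.1 (multiplicative Lidskii inequality with its equality case). Notation. For $x\in\mathbb{R}^d$ let $x^\downarrow$ and $x^\uparrow$ be the rearrangements of $x$ in decreasing and increasing order; $(\mathbb{R}_{>0}^d)^\downarrow$ is the set of vectors $x$ with positive entries such that $x=x^\downarrow$; $x\circ y=(x_iy_i)_{i}$ is the entrywise product. For $x,y\in\mathbb{R}_{\ge 0}^d$ write $x\prec_{\log}y$ if $$\prod_{i=1}^k x_i^\downarrow\le\prod_{i=1}^k y_i^\downarrow\quad(1\le k\le d-1)\qquad\text{and}\qquad \prod_{i=1}^d x_i^\downarrow=\prod_{i=1}^d y_i^\downarrow .$$ For a Hermitian $d\times d$ matrix $A$, $\lambda(A)=(\lambda_i(A))_{i=1}^d$ is the vector of its eigenvalues, counted with multiplicity, in decreasing order. For $x,y\in\mathbb{C}^d$, $x\otimes y$ is the operator $z\mapsto\langle z,y\rangle x$, and $|A|=(A^*A)^{1/2}$. Statement. Let $S$ be a complex $d\times d$ matrix that is positive semidefinite and invertible, and let $\gamma\in(\mathbb{R}_{>0}^d)^\downarrow$. Then, for every invertible complex $d\times d$ matrix $V$ such that $\lambda(V^*V)=\gamma$,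 $$\lambda(S)\circ\gamma^\uparrow\prec_{\log}\lambda(V^*SV)\prec_{\log}\lambda(S)\circ\gamma\in(\mathbb{R}_{>0}^d)^\downarrow .$$ Moreover, if $\lambda(V^*SV)=(\lambda(S)\circ\gamma^\uparrow)^\downarrow$, then there exists an orthonormal basis $\{v_i\}_{i=1}^d$ of $\mathbb{C}^d$ such that $$S=\sum_{i=1}^d\lambda_i(S)\,v_i\otimes v_i\quad\text{and}\quad |V^*|=\sum_{i=1}^d\gamma_{d+1-i}^{1/2}\,v_i\otimes v_i ;$$ and if $\lambda(V^*SV)=\lambda(S)\circ\gamma$, then there exists an orthonormal basis $\{v_i\}_{i=1}^d$ of $\mathbb{C}^d$ such that $$S=\sum_{i=1}^d\lambda_i(S)\,v_i\otimes v_i\quad\text{and}\quad |V^*|=\sum_{i=1}^d\gamma_i^{1/2}\,v_i\otimes v_i .$$ -/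

import Mathlib

open scoped MatrixOrder ComplexOrder

noncomputable section

namespace Lidskii

/-- The vector `x` rearranged in increasing order. -/
def incr {d : ℕ} (x : Fin d → ℝ) : Fin d → ℝ :=
  x ∘ Tuple.sort x

/-- The vector `x` rearranged in decreasing order. -/
def decr {d : ℕ} (x : Fin d → ℝ) : Fin d → ℝ :=
  fun i => incr x (Fin.rev i)

/-- The vectors with positive entries that are arranged in decreasing order. -/
def posDecr (d : ℕ) : Set (Fin d → ℝ) :=
  {x | (∀ i, 0 < x i) ∧ x = decr x}

/-- Log-majorization of `x` by `y`, a relation between vectors with nonnegative entries: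
the product of the `k` largest entries of `x` is at most that of `y` for `1 ≤ k ≤ d - 1`,
and the products of all the entries agree. -/
def LogMajorized {d : ℕ} (x y : Fin d → ℝ) : Prop :=
  (∀ i, 0 ≤ x i) ∧ (∀ i, 0 ≤ y i) ∧
    (∀ k : ℕ, 1 ≤ k → k < d →
      ∏ i : Fin d with i.val < k, decr x i ≤ ∏ i : Fin d with i.val < k, decr y i) ∧
    ∏ i, decr x i = ∏ i, decr y i

/-- The eigenvalues of a Hermitian `d × d` matrix, counted with multiplicity and arranged in
decreasing order. -/
def eig {d : ℕ} {A : Matrix (Fin d) (Fin d) ℂ} (hA : A.IsHermitian) : Fin d → ℝ :=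
  fun i => hA.eigenvalues₀ (Fin.cast (Fintype.card_fin d).symm i)

/-- The matrix of the rank one operator `z ↦ ⟨z, y⟩ x` (inner product linear in `z`). -/
def outer {d : ℕ} (x y : EuclideanSpace ℂ (Fin d)) : Matrix (Fin d) (Fin d) ℂ :=
  Matrix.vecMulVec x.ofLp (star y.ofLp)

end Lidskii

end

/-!
Both log-majorizations come from the Gelfand–Naimark inequality `prod_eig_conj_le`: for invertible
`X`, positive definite `C` and every set `J` of `k` indices, the product over `J` of the eigenvalues
of `Xᴴ * C * X` is at most the product over `J` of those of `Xᴴ * X` times the product of the `k`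
largest eigenvalues of `C`. It is proved by the method of Li and Mathias, from Weyl's monotonicity
principle `eig_mono` and determinants alone. With `X = V` and `C = S` it is the upper bound, and
with `X = V⁻¹` and `C = Vᴴ * S * V` it is the lower bound `prod_eig_mul_rev_le`, because
the eigenvalues of `(V⁻¹)ᴴ * V⁻¹` are the inverses of the `γ i` in opposite order.

In the equality cases only the sum of the eigenvalues matters: it is the trace of `S * (V * Vᴴ)`,
and `V * Vᴴ` has the eigenvalues `γ` too. Equality on the right is then equality in von Neumann's
inequality `tr (A * B) ≤ ∑ i, λ i (A) * λ i (B)` for `A = S` and `B = V * Vᴴ`; equality on the left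
is the same for `A = S` and `B = -(V * Vᴴ)`. In that case an eigenbasis of `A + B` diagonalizes both
`A` and `B`, in decreasing order (`exists_spec_of_trace_eq`): the inequality for the pairs
`(A, A + B)` and `(B, A + B)` forces `λ (A + B) = λ A + λ B`, and the inequality for `A` and the
matrix `A'` that has the eigenvalues of `A` in the eigenbasis of `A + B` forces
`tr ((A - A') ^ 2) = 0`. Finally `|Vᴴ|` is the square root of `V * Vᴴ`.
-/

namespace Lidskii

open Matrix Finset

variable {d : ℕ}

/-! ### Matrices with a given orthonormal eigenbasis -/

/-- The matrix whose columns are the vectors of an orthonormal basis. -/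
noncomputable def colMatrix (v : OrthonormalBasis (Fin d) ℂ (EuclideanSpace ℂ (Fin d))) :
    Matrix (Fin d) (Fin d) ℂ :=
  Matrix.of fun p i => v i p

/-- The Hermitian matrix with eigenvector `v i` for the eigenvalue `x i`. -/
noncomputable def spec (v : OrthonormalBasis (Fin d) ℂ (EuclideanSpace ℂ (Fin d)))
    (x : Fin d → ℝ) : Matrix (Fin d) (Fin d) ℂ :=
  ∑ i, (x i : ℂ) • outer (v i) (v i)

section spec

variable (u v w : OrthonormalBasis (Fin d) ℂ (EuclideanSpace ℂ (Fin d))) (x y : Fin d → ℝ)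

lemma colMatrix_conjTranspose_mul_self : (colMatrix v)ᴴ * colMatrix v = 1 := by
  ext i j
  have h := orthonormal_iff_ite.mp v.orthonormal i j
  rw [EuclideanSpace.inner_eq_star_dotProduct] at h
  simp only [mul_apply, conjTranspose_apply, colMatrix, of_apply, one_apply]
  rw [← h]
  simp [dotProduct, mul_comm]

lemma colMatrix_mul_conjTranspose_self : colMatrix v * (colMatrix v)ᴴ = 1 :=
  mul_eq_one_comm.mp (colMatrix_conjTranspose_mul_self v)

lemma spec_eq : spec v x = colMatrix v * diagonal (fun i => (x i : ℂ)) * (colMatrix v)ᴴ := by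
  ext p q
  simp [spec, outer, Matrix.sum_apply, mul_apply, colMatrix, vecMulVec_apply, diagonal_apply]
  refine Finset.sum_congr rfl fun i _ => by ring

lemma spec_add : spec v (x + y) = spec v x + spec v y := by
  simp [spec, add_smul, Finset.sum_add_distrib]

lemma spec_neg : spec v (-x) = -spec v x := by
  simp [spec]

lemma spec_mul : spec v (x * y) = spec v x * spec v y := by
  simp only [spec_eq]
  have h : ∀ D E : Matrix (Fin d) (Fin d) ℂ,
      colMatrix v * D * (colMatrix v)ᴴ * (colMatrix v * E * (colMatrix v)ᴴ) =
        colMatrix v * (D * E) * (colMatrix v)ᴴ := fun D E => by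
    simp only [Matrix.mul_assoc]
    rw [← Matrix.mul_assoc (colMatrix v)ᴴ (colMatrix v), colMatrix_conjTranspose_mul_self,
      Matrix.one_mul]
  rw [h, diagonal_mul_diagonal]
  simp only [Pi.mul_apply, Complex.ofReal_mul]

lemma spec_const (c : ℝ) : spec v (fun _ => c) = (c : ℂ) • 1 := by
  rw [spec_eq, ← smul_one_eq_diagonal, Matrix.mul_smul, Matrix.smul_mul, Matrix.mul_one,
    colMatrix_mul_conjTranspose_self]

lemma spec_reindex (e : Equiv.Perm (Fin d)) : spec (v.reindex e) (x ∘ e.symm) = spec v x := by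
  simp only [spec, OrthonormalBasis.reindex_apply, Function.comp]
  exact Equiv.sum_comp e.symm fun i => (x i : ℂ) • outer (v i) (v i)

lemma isHermitian_spec : (spec v x).IsHermitian := by
  rw [spec_eq]
  refine isHermitian_mul_mul_conjTranspose _ ?_
  rw [IsHermitian, diagonal_conjTranspose]
  congr 1
  ext i
  simp

variable {x} in
lemma posSemidef_spec (hx : ∀ i, 0 ≤ x i) : (spec v x).PosSemidef := by
  rw [spec_eq]
  refine PosSemidef.mul_mul_conjTranspose_same (PosSemidef.diagonal fun i => ?_) _
  simpa using hx i

lemma charpoly_spec : (spec v x).charpoly = (diagonal fun i => (x i : ℂ)).charpoly := by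
  rw [spec_eq, charpoly_mul_comm, ← Matrix.mul_assoc, colMatrix_conjTranspose_mul_self,
    Matrix.one_mul]

lemma det_spec : (spec v x).det = ((∏ i, x i : ℝ) : ℂ) := by
  rw [spec_eq, det_mul_right_comm, colMatrix_mul_conjTranspose_self]
  simp

/-! ### Eigenvalues of Hermitian matrices in decreasing order -/

/-- The eigenvalues of a Hermitian matrix depend on its characteristic polynomial only. -/
lemma eig_eq_of_charpoly {A B : Matrix (Fin d) (Fin d) ℂ} (hA : A.IsHermitian)
    (hB : B.IsHermitian) (h : A.charpoly = B.charpoly) : eig hA = eig hB := by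
  have : hA.eigenvalues₀ = hB.eigenvalues₀ := by
    rw [← List.ofFn_inj, ← IsHermitian.sort_roots_charpoly_eq_eigenvalues₀,
      ← IsHermitian.sort_roots_charpoly_eq_eigenvalues₀, h]
  exact funext fun i => congrFun this _

lemma eig_antitone {A : Matrix (Fin d) (Fin d) ℂ} (hA : A.IsHermitian) : Antitone (eig hA) :=
  fun _ _ h => hA.eigenvalues₀_antitone h

/-- In any diagonalization with decreasing eigenvalues, these are the values of `eig`. -/
lemma eig_eq_of_eq_spec {A : Matrix (Fin d) (Fin d) ℂ} (hA : A.IsHermitian) {x : Fin d → ℝ}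
    (hx : Antitone x) (h : A = spec v x) : eig hA = x := by
  have h1 := hA.sort_roots_charpoly_eq_eigenvalues₀
  have h2 : A.charpoly.roots = Multiset.map (fun i => (x i : ℂ)) Finset.univ.val := by
    rw [h, charpoly_spec, charpoly_diagonal, Polynomial.roots_prod]
    · simp
    · simp [Finset.prod_ne_zero_iff, Polynomial.X_sub_C_ne_zero]
  have h3 : (A.charpoly.roots.map RCLike.re).sort (· ≥ ·) = List.ofFn x := by
    rw [h2, Fin.univ_val_map, Multiset.map_coe, List.map_ofFn]
    simp only [Function.comp_def, Multiset.coe_sort]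
    apply List.mergeSort_of_pairwise
    simp_rw [decide_eq_true_eq, ← List.sortedGE_iff_pairwise]
    exact hx.sortedGE_ofFn
  have h4 : List.ofFn (eig hA) = List.ofFn x := by
    rw [← h3, h1]
    exact (List.ofFn_congr (Fintype.card_fin d).symm (eig hA)).trans rfl
  exact List.ofFn_injective h4

/-- A Hermitian matrix is diagonalized by an orthonormal basis, in the order of `eig`. -/
lemma exists_eq_spec {A : Matrix (Fin d) (Fin d) ℂ} (hA : A.IsHermitian) :
    ∃ v : OrthonormalBasis (Fin d) ℂ (EuclideanSpace ℂ (Fin d)), A = spec v (eig hA) := by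
  let e : Fin d ≃ Fin d := (finCongr (Fintype.card_fin d).symm).trans
    (Fintype.equivOfCardEq (Fintype.card_fin _))
  have he : ∀ i, hA.eigenvalues (e i) = eig hA i := fun i => by
    simp [IsHermitian.eigenvalues, eig, e]
  refine ⟨hA.eigenvectorBasis.reindex e.symm, ?_⟩
  set v := hA.eigenvectorBasis.reindex e.symm
  have h : A * colMatrix v = colMatrix v * diagonal (fun i => (eig hA i : ℂ)) := by
    ext p i
    have h1 := congrFun (hA.mulVec_eigenvectorBasis (e i)) p
    rw [he] at h1
    rw [mul_diagonal]
    simpa [mul_apply, colMatrix, v, mulVec, dotProduct, mul_comm] using h1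
  rw [spec_eq, ← h, Matrix.mul_assoc, colMatrix_mul_conjTranspose_self, Matrix.mul_one]

lemma eig_pos {A : Matrix (Fin d) (Fin d) ℂ} (hA : A.PosDef) (i : Fin d) :
    0 < eig hA.isHermitian i := by
  have h := hA.eigenvalues_pos (Fintype.equivOfCardEq (Fintype.card_fin _)
    (Fin.cast (Fintype.card_fin d).symm i))
  simpa [IsHermitian.eigenvalues, eig] using h

lemma det_eq_prod_eig {A : Matrix (Fin d) (Fin d) ℂ} (hA : A.IsHermitian) :
    A.det = ((∏ i, eig hA i : ℝ) : ℂ) := by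
  obtain ⟨v, hv⟩ := exists_eq_spec hA
  conv_lhs => rw [hv]
  exact det_spec v _

lemma trace_eq_sum_eig {A : Matrix (Fin d) (Fin d) ℂ} (hA : A.IsHermitian) :
    A.trace = ((∑ i, eig hA i : ℝ) : ℂ) := by
  obtain ⟨v, hv⟩ := exists_eq_spec hA
  conv_lhs => rw [hv]
  rw [spec_eq, trace_mul_comm, ← Matrix.mul_assoc, colMatrix_conjTranspose_mul_self,
    Matrix.one_mul, trace_diagonal]
  simp

/-! ### Von Neumann's trace inequality and its equality case -/

lemma trace_spec_mul_spec :
    (spec v x * spec w y).trace =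
      ((∑ i, ∑ j, x i * y j * Complex.normSq (((colMatrix v)ᴴ * colMatrix w) i j) : ℝ) : ℂ) := by
  set Q := (colMatrix v)ᴴ * colMatrix w with hQ
  have h : (spec v x * spec w y).trace =
      (diagonal (fun i => (x i : ℂ)) * (Q * diagonal (fun i => (y i : ℂ)) * Qᴴ)).trace := by
    rw [spec_eq, spec_eq, hQ, conjTranspose_mul, conjTranspose_conjTranspose]
    simp only [Matrix.mul_assoc]
    rw [trace_mul_comm]
    simp only [Matrix.mul_assoc]
  rw [h, trace]
  push_cast
  refine Finset.sum_congr rfl fun i _ => ?_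
  rw [diag_apply, diagonal_mul, mul_apply, Finset.mul_sum]
  refine Finset.sum_congr rfl fun j _ => ?_
  rw [mul_diagonal, conjTranspose_apply, Complex.normSq_eq_conj_mul_self]
  simp only [RCLike.star_def]
  ring

lemma trace_spec_mul_spec_self : (spec v x * spec v y).trace = ((∑ i, x i * y i : ℝ) : ℂ) := by
  rw [trace_spec_mul_spec, colMatrix_conjTranspose_mul_self]
  simp [one_apply, apply_ite Complex.normSq]

lemma normSq_mem_doublyStochastic :
    (Matrix.of fun i j => Complex.normSq (((colMatrix v)ᴴ * colMatrix w) i j)) ∈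
      doublyStochastic ℝ (Fin d) := by
  set Q := (colMatrix v)ᴴ * colMatrix w with hQ
  have h1 : Q * Qᴴ = 1 := by
    rw [hQ, conjTranspose_mul, conjTranspose_conjTranspose, Matrix.mul_assoc,
      ← Matrix.mul_assoc (colMatrix w), colMatrix_mul_conjTranspose_self, Matrix.one_mul,
      colMatrix_conjTranspose_mul_self]
  have h2 : Qᴴ * Q = 1 := mul_eq_one_comm.mp h1
  refine mem_doublyStochastic_iff_sum.mpr ⟨fun i j => Complex.normSq_nonneg _, fun i => ?_,
    fun j => ?_⟩
  · have h := congrFun (congrFun h1 i) i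
    simp only [mul_apply, conjTranspose_apply, one_apply_eq, RCLike.star_def,
      Complex.mul_conj] at h
    exact_mod_cast h
  · have h := congrFun (congrFun h2 j) j
    simp only [mul_apply, conjTranspose_apply, one_apply_eq, RCLike.star_def,
      ← Complex.normSq_eq_conj_mul_self] at h
    exact_mod_cast h

variable {x y} in
/-- **Von Neumann's trace inequality** for Hermitian matrices. By Birkhoff's theorem the
trace is an average of the sums `∑ i, x i * y (σ i)`, which the rearrangement inequality bounds. -/
lemma trace_spec_mul_spec_le (hx : Antitone x) (hy : Antitone y) :
    (spec v x * spec w y).trace.re ≤ ∑ i, x i * y i := by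
  obtain ⟨t, ht0, ht1, ht⟩ := exists_eq_sum_perm_of_mem_doublyStochastic
    (normSq_mem_doublyStochastic v w)
  have hQ : ∀ i j, Complex.normSq (((colMatrix v)ᴴ * colMatrix w) i j) =
      ∑ σ : Equiv.Perm (Fin d), t σ * (σ.permMatrix ℝ) i j := fun i j => by
    have h := congrFun (congrFun ht i) j
    rw [of_apply] at h
    rw [← h]
    simp [Matrix.sum_apply]
  rw [trace_spec_mul_spec, Complex.ofReal_re]
  calc ∑ i, ∑ j, x i * y j * Complex.normSq (((colMatrix v)ᴴ * colMatrix w) i j)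
      = ∑ i, ∑ σ : Equiv.Perm (Fin d), t σ * (x i * y (σ i)) := by
        refine Finset.sum_congr rfl fun i _ => ?_
        simp_rw [hQ, Finset.mul_sum]
        rw [Finset.sum_comm]
        refine Finset.sum_congr rfl fun σ _ => ?_
        rw [Finset.sum_eq_single (σ i)]
        · simp [Equiv.Perm.permMatrix, PEquiv.toMatrix_apply]
          ring
        · intro j _ hj
          simp [Equiv.Perm.permMatrix, PEquiv.toMatrix_apply, hj.symm]
        · simp
    _ = ∑ σ : Equiv.Perm (Fin d), t σ * ∑ i, x i * y (σ i) := by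
        rw [Finset.sum_comm]
        simp_rw [Finset.mul_sum]
    _ ≤ ∑ σ : Equiv.Perm (Fin d), t σ * ∑ i, x i * y i :=
        Finset.sum_le_sum fun σ _ => mul_le_mul_of_nonneg_left
          ((hx.monovary hy).sum_mul_comp_perm_le_sum_mul) (ht0 σ)
    _ = ∑ i, x i * y i := by rw [← Finset.sum_mul, ht1, one_mul]

variable {x y} in
/-- The equality case of von Neumann's trace inequality: if equality holds, then an eigenbasis of
the sum of the two matrices diagonalizes both of them. -/
lemma exists_spec_of_trace_eq (hx : Antitone x) (hy : Antitone y)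
    (h : (spec v x * spec w y).trace.re = ∑ i, x i * y i) :
    ∃ u : OrthonormalBasis (Fin d) ℂ (EuclideanSpace ℂ (Fin d)),
      spec v x = spec u x ∧ spec w y = spec u y := by
  set A := spec v x with hA
  set B := spec w y with hB
  have hM : (A + B).IsHermitian := (isHermitian_spec v x).add (isHermitian_spec w y)
  obtain ⟨u, hu⟩ := exists_eq_spec hM
  have hm := eig_antitone hM
  set m := eig hM
  have hBA : (B * A).trace.re = ∑ i, x i * y i := by rw [trace_mul_comm, h]
  have hAA : (A * A).trace.re = ∑ i, x i * x i := by
    rw [hA, trace_spec_mul_spec_self, Complex.ofReal_re]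
  have hBB : (B * B).trace.re = ∑ i, y i * y i := by
    rw [hB, trace_spec_mul_spec_self, Complex.ofReal_re]
  have hMM : ((A + B) * (A + B)).trace.re = ∑ i, m i * m i := by
    rw [hu, trace_spec_mul_spec_self, Complex.ofReal_re]
  have hMM' := hMM
  simp only [Matrix.mul_add, Matrix.add_mul, trace_add, Complex.add_re, h, hBA, hAA, hBB]
    at hMM'
  have hAM : (A * (A + B)).trace.re ≤ ∑ i, x i * m i := by
    rw [hu]; exact trace_spec_mul_spec_le v u hx hm
  have hBM : (B * (A + B)).trace.re ≤ ∑ i, y i * m i := by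
    rw [hu]; exact trace_spec_mul_spec_le w u hy hm
  simp only [Matrix.mul_add, trace_add, Complex.add_re, h, hBA, hAA, hBB] at hAM hBM
  -- The two inequalities bound the squared distance from `x + y` to `m` by zero.
  have hmxy : m = x + y := by
    have hsq : ∑ i, (x i + y i - m i) ^ 2 = ∑ i, x i * x i + ∑ i, y i * y i + ∑ i, m i * m i
        + 2 * ∑ i, x i * y i - 2 * ∑ i, x i * m i - 2 * ∑ i, y i * m i := by
      simp only [Finset.mul_sum, ← Finset.sum_add_distrib, ← Finset.sum_sub_distrib]
      exact Finset.sum_congr rfl fun i _ => by ring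
    have h0 : ∑ i, (x i + y i - m i) ^ 2 = 0 :=
      le_antisymm (by linarith) (Finset.sum_nonneg fun i _ => sq_nonneg _)
    rw [Finset.sum_eq_zero_iff_of_nonneg fun i _ => sq_nonneg _] at h0
    ext i
    have := pow_eq_zero_iff (two_ne_zero) |>.mp (h0 i (Finset.mem_univ i))
    simp only [Pi.add_apply]
    linarith
  rw [hmxy, spec_add] at hu
  have h1 : (A * spec u x).trace.re ≤ ∑ i, x i * x i := trace_spec_mul_spec_le v u hx hx
  have h2 : (A * spec u y).trace.re ≤ ∑ i, x i * y i := trace_spec_mul_spec_le v u hx hy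
  have h3 : (A * (spec u x + spec u y)).trace.re = ∑ i, x i * x i + ∑ i, x i * y i := by
    rw [← hu]
    simp only [Matrix.mul_add, trace_add, Complex.add_re, h, hAA]
  simp only [Matrix.mul_add, trace_add, Complex.add_re] at h3
  have hD : A - spec u x = 0 := by
    have hherm : (A - spec u x)ᴴ = A - spec u x :=
      (isHermitian_spec v x).sub (isHermitian_spec u x)
    have hpos := (posSemidef_conjTranspose_mul_self (A - spec u x)).trace_nonneg
    have hre : ((A - spec u x)ᴴ * (A - spec u x)).trace.re = 0 := by
      rw [hherm]
      simp only [Matrix.mul_sub, Matrix.sub_mul, trace_sub, Complex.sub_re, hAA,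
        trace_spec_mul_spec_self, Complex.ofReal_re]
      rw [trace_mul_comm (spec u x) A]
      linarith
    refine trace_conjTranspose_mul_self_eq_zero_iff.mp (Complex.ext hre ?_)
    exact (Complex.nonneg_iff.mp hpos).2.symm
  have hAu : A = spec u x := sub_eq_zero.mp hD
  exact ⟨u, hAu, by rw [hAu] at hu; exact add_left_cancel hu⟩

/-! ### Monotonicity of eigenvalues -/

/-- The quadratic form of `spec v x`, in coordinates with respect to `v`. -/
lemma dotProduct_spec_mulVec (z : Fin d → ℂ) :
    star z ⬝ᵥ (spec v x *ᵥ z) =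
      ((∑ i, x i * Complex.normSq (((colMatrix v)ᴴ *ᵥ z) i) : ℝ) : ℂ) := by
  rw [spec_eq, ← mulVec_mulVec, ← mulVec_mulVec, dotProduct_mulVec]
  have : star z ᵥ* colMatrix v = star ((colMatrix v)ᴴ *ᵥ z) := by
    rw [star_mulVec, conjTranspose_conjTranspose]
  rw [this]
  simp only [dotProduct, mulVec_diagonal, Pi.star_apply, Complex.ofReal_sum, Complex.ofReal_mul,
    Complex.normSq_eq_conj_mul_self]
  refine Finset.sum_congr rfl fun i _ => ?_
  simp only [RCLike.star_def]
  ring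

variable {x y} in
/-- **Weyl's monotonicity principle.** A dimension count gives a nonzero vector orthogonal to
the eigenvectors `v j` with `i < j` and to the `w j` with `j < i`; the quadratic forms are compared
at this vector. -/
lemma le_of_spec_le_spec (hx : Antitone x) (hy : Antitone y) (h : spec v x ≤ spec w y) :
    x ≤ y := by
  intro i
  let M : Matrix (Fin d) (Fin d) ℂ := Matrix.of fun j p =>
    if j = i then 0 else if i < j then (colMatrix v)ᴴ j p else (colMatrix w)ᴴ j p
  obtain ⟨z, hz0, hz⟩ := exists_mulVec_eq_zero_iff.mpr
    (det_eq_zero_of_row_eq_zero (A := M) i fun p => by simp [M])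
  have hv : ∀ j, i < j → ((colMatrix v)ᴴ *ᵥ z) j = 0 := fun j hj => by
    have := congrFun hz j
    simpa [M, mulVec, dotProduct, hj, hj.ne'] using this
  have hw : ∀ j, j < i → ((colMatrix w)ᴴ *ᵥ z) j = 0 := fun j hj => by
    have := congrFun hz j
    simpa [M, mulVec, dotProduct, hj.ne, hj.not_gt] using this
  have hnorm : ∀ u : OrthonormalBasis (Fin d) ℂ (EuclideanSpace ℂ (Fin d)),
      ∑ j, Complex.normSq (((colMatrix u)ᴴ *ᵥ z) j) = (star z ⬝ᵥ z).re := fun u => by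
    have h1 := dotProduct_spec_mulVec u (fun _ => 1) z
    rw [spec_const] at h1
    simp only [Complex.ofReal_one, one_smul, one_mulVec, one_mul] at h1
    rw [h1, Complex.ofReal_re]
  have hpos : 0 < (star z ⬝ᵥ z).re :=
    (Complex.pos_iff.mp (dotProduct_star_self_pos_iff.mpr hz0)).1
  have hxy := (Complex.nonneg_iff.mp (PosSemidef.dotProduct_mulVec_nonneg (le_iff.mp h) z)).1
  rw [sub_mulVec, dotProduct_sub, dotProduct_spec_mulVec, dotProduct_spec_mulVec,
    Complex.sub_re, Complex.ofReal_re, Complex.ofReal_re] at hxy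
  have h1 : x i * (star z ⬝ᵥ z).re ≤ ∑ j, x j * Complex.normSq (((colMatrix v)ᴴ *ᵥ z) j) := by
    rw [← hnorm v, Finset.mul_sum]
    refine Finset.sum_le_sum fun j _ => ?_
    rcases lt_or_ge i j with hj | hj
    · simp [hv j hj]
    · exact mul_le_mul_of_nonneg_right (hx hj) (Complex.normSq_nonneg _)
  have h2 : ∑ j, y j * Complex.normSq (((colMatrix w)ᴴ *ᵥ z) j) ≤ y i * (star z ⬝ᵥ z).re := by
    rw [← hnorm w, Finset.mul_sum]
    refine Finset.sum_le_sum fun j _ => ?_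
    rcases lt_or_ge j i with hj | hj
    · simp [hw j hj]
    · exact mul_le_mul_of_nonneg_right (hy hj) (Complex.normSq_nonneg _)
  exact le_of_mul_le_mul_right (by linarith) hpos

end spec

lemma eig_mono {A B : Matrix (Fin d) (Fin d) ℂ} (hA : A.IsHermitian) (hB : B.IsHermitian)
    (h : A ≤ B) : eig hA ≤ eig hB := by
  obtain ⟨v, hv⟩ := exists_eq_spec hA
  obtain ⟨w, hw⟩ := exists_eq_spec hB
  refine le_of_spec_le_spec v w (eig_antitone hA) (eig_antitone hB) ?_
  rw [← hv, ← hw]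
  exact h

lemma eig_smul {A : Matrix (Fin d) (Fin d) ℂ} (hA : A.IsHermitian) {c : ℝ} (hc : 0 ≤ c)
    (hcA : ((c : ℂ) • A).IsHermitian) : eig hcA = fun i => c * eig hA i := by
  obtain ⟨v, hv⟩ := exists_eq_spec hA
  refine eig_eq_of_eq_spec v hcA (fun i j hij => mul_le_mul_of_nonneg_left
    (eig_antitone hA hij) hc) ?_
  conv_lhs => rw [hv]
  simp only [spec, Finset.smul_sum, smul_smul, Complex.ofReal_mul]

/-! ### Decreasing rearrangements and log-majorization -/

lemma decr_eq_comp (x : Fin d → ℝ) : decr x = x ∘ (Fin.revPerm.trans (Tuple.sort x)) := rfl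

lemma incr_of_antitone {x : Fin d → ℝ} (hx : Antitone x) : incr x = x ∘ Fin.rev := by
  have h : Monotone (x ∘ (Fin.revPerm : Equiv.Perm (Fin d))) := fun _ _ h =>
    hx (Fin.rev_le_rev.mpr h)
  exact (Tuple.comp_sort_eq_comp_iff_monotone.mpr h).symm

lemma decr_of_antitone {x : Fin d → ℝ} (hx : Antitone x) : decr x = x := by
  ext i
  simp [decr, incr_of_antitone hx]

lemma prod_decr (x : Fin d → ℝ) : ∏ i, decr x i = ∏ i, x i := by
  rw [decr_eq_comp]
  exact Equiv.prod_comp _ x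

lemma sum_decr (x : Fin d → ℝ) : ∑ i, decr x i = ∑ i, x i := by
  rw [decr_eq_comp]
  exact Equiv.sum_comp _ x

lemma card_filter_val_lt {k : ℕ} (hk : k < d) :
    (univ.filter fun i : Fin d => i.val < k).card = k := by
  rw [Fin.card_filter_val_lt, min_eq_right hk.le]

/-- The product of the `k` largest entries of `x` is the product over some `k` indices. -/
lemma exists_prod_decr_eq (x : Fin d → ℝ) {k : ℕ} (hk : k < d) :
    ∃ J : Finset (Fin d), J.card = k ∧
      ∏ i : Fin d with i.val < k, decr x i = ∏ j ∈ J, x j := by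
  refine ⟨(univ.filter fun i : Fin d => i.val < k).map
    (Fin.revPerm.trans (Tuple.sort x)).toEmbedding, ?_, ?_⟩
  · rw [card_map, card_filter_val_lt hk]
  · rw [prod_map, decr_eq_comp]
    rfl

lemma logMajorized_of_prod_le {x y : Fin d → ℝ} (hx : ∀ i, 0 ≤ x i) (hy : ∀ i, 0 ≤ y i)
    (hy' : Antitone y) (h : ∏ i, x i = ∏ i, y i)
    (hJ : ∀ J : Finset (Fin d), J.card < d →
      ∏ j ∈ J, x j ≤ ∏ i : Fin d with i.val < J.card, y i) :
    LogMajorized x y := by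
  refine ⟨hx, hy, fun k _ hk => ?_, by rw [prod_decr, prod_decr, h]⟩
  obtain ⟨J, hJk, hJx⟩ := exists_prod_decr_eq x hk
  rw [hJx, decr_of_antitone hy']
  have := hJ J (hJk ▸ hk)
  rwa [hJk] at this

/-! ### The multiplicative inequalities -/

/-- The **Gelfand–Naimark inequality**, by the method of Li and Mathias: raising to the `k`-th
eigenvalue `c` of `C` all smaller ones, with `k` the size of `J`, gives a matrix `C'` that
dominates both `C` and `c • 1`. So monotonicity bounds the eigenvalues of `Xᴴ * C * X` by those of
`Xᴴ * C' * X`, and bounds the latter below by `c` times those of `Xᴴ * X`; determinants turn the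
lower bound outside `J` into an upper bound on `J`. -/
lemma prod_eig_conj_le {X C : Matrix (Fin d) (Fin d) ℂ} (hX : IsUnit X) (hC : C.PosDef)
    (J : Finset (Fin d)) :
    ∏ j ∈ J, eig (isHermitian_conjTranspose_mul_mul X hC.isHermitian) j ≤
      (∏ j ∈ J, eig (isHermitian_conjTranspose_mul_self X) j) *
        ∏ i : Fin d with i.val < J.card, eig hC.isHermitian i := by
  rcases J.eq_empty_or_nonempty with rfl | hJ
  · simp
  have hXinj : Function.Injective X.mulVec := mulVec_injective_iff_isUnit.mpr hX
  have hJd : J.card ≤ d := by simpa using J.card_le_univ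
  have hJ0 : 0 < J.card := hJ.card_pos
  set s := eig hC.isHermitian with hs
  have hsa : Antitone s := eig_antitone hC.isHermitian
  set c := s ⟨J.card - 1, by omega⟩ with hc
  have hc0 : 0 < c := eig_pos hC _
  obtain ⟨v, hv⟩ := exists_eq_spec hC.isHermitian
  rw [← hs] at hv
  set t : Fin d → ℝ := fun i => max (s i) c with ht
  set C' := spec v t with hC'
  have hCC' : C ≤ C' := by
    rw [le_iff, hC', hv, sub_eq_add_neg, ← spec_neg, ← spec_add]
    exact posSemidef_spec v fun i => by simp [ht]
  have hcC' : (c : ℂ) • 1 ≤ C' := by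
    rw [le_iff, hC', ← spec_const v c, sub_eq_add_neg, ← spec_neg, ← spec_add]
    exact posSemidef_spec v fun i => by simp [ht]
  have hherm : (Xᴴ * C' * X).IsHermitian :=
    isHermitian_conjTranspose_mul_mul X (isHermitian_spec v t)
  have hconj : ∀ {A B : Matrix (Fin d) (Fin d) ℂ}, A ≤ B → Xᴴ * A * X ≤ Xᴴ * B * X :=
    fun {A B} h => by
      rw [le_iff, ← Matrix.sub_mul, ← Matrix.mul_sub]
      exact (le_iff.mp h).conjTranspose_mul_mul_same X
  set x := eig (isHermitian_conjTranspose_mul_self X) with hx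
  set l := eig (isHermitian_conjTranspose_mul_mul X hC.isHermitian) with hl
  set m := eig hherm
  have hl0 : ∀ i, 0 < l i := eig_pos (hC.conjTranspose_mul_mul_same hXinj)
  have hx0 : ∀ i, 0 < x i := eig_pos (PosDef.conjTranspose_mul_self X hXinj)
  have hlm : ∀ i, l i ≤ m i := eig_mono _ _ (hconj hCC')
  have hXX : Xᴴ * ((c : ℂ) • 1) * X = (c : ℂ) • (Xᴴ * X) := by
    rw [Matrix.mul_smul, Matrix.mul_one, Matrix.smul_mul]
  have hcX : ((c : ℂ) • (Xᴴ * X)).IsHermitian := by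
    rw [← hXX, ← spec_const v c]
    exact isHermitian_conjTranspose_mul_mul X (isHermitian_spec v _)
  have hxm : ∀ i, c * x i ≤ m i := fun i => by
    have h := eig_mono hcX hherm (hXX ▸ hconj hcC') i
    rwa [eig_smul (isHermitian_conjTranspose_mul_self X) hc0.le] at h
  have hm0 : ∀ i, 0 < m i := fun i => (hl0 i).trans_le (hlm i)
  have hdet : ∏ i, m i = (∏ i, x i) * ∏ i, t i := by
    have h := det_eq_prod_eig hherm
    have h' := det_eq_prod_eig (isHermitian_conjTranspose_mul_self X)
    rw [det_mul_right_comm, det_mul, h', show C'.det = _ from det_spec v t] at h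
    exact_mod_cast h.symm
  have htprod : ∏ i, t i = (∏ i : Fin d with i.val < J.card, s i) * c ^ Jᶜ.card := by
    rw [← prod_filter_mul_prod_filter_not univ (fun i : Fin d => i.val < J.card)]
    congr 1
    · refine prod_congr rfl fun i hi => max_eq_left (hsa ?_)
      rw [Fin.le_def]
      exact Nat.le_sub_one_of_lt (mem_filter.mp hi).2
    · rw [prod_congr rfl (g := fun _ => c) fun i hi => max_eq_right (hsa ?_), prod_const]
      · congr 1
        have h1 := card_filter_add_card_filter_not (s := (univ : Finset (Fin d)))
          (fun i : Fin d => i.val < J.card)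
        rw [Fin.card_filter_val_lt, card_univ, Fintype.card_fin, min_eq_right hJd] at h1
        rw [card_compl, Fintype.card_fin]
        omega
      · have := (mem_filter.mp hi).2
        rw [Fin.le_def]
        simp only
        omega
  have hcomp : c ^ Jᶜ.card * ∏ i ∈ Jᶜ, x i ≤ ∏ i ∈ Jᶜ, m i := by
    rw [← prod_const, ← prod_mul_distrib]
    exact prod_le_prod (fun i _ => (mul_pos hc0 (hx0 i)).le) fun i _ => hxm i
  have hpos : 0 < c ^ Jᶜ.card * ∏ i ∈ Jᶜ, x i :=
    mul_pos (pow_pos hc0 _) (prod_pos fun i _ => hx0 i)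
  have hmJ : (∏ j ∈ J, m j) * (c ^ Jᶜ.card * ∏ i ∈ Jᶜ, x i) ≤
      ((∏ j ∈ J, x j) * ∏ i : Fin d with i.val < J.card, s i) *
        (c ^ Jᶜ.card * ∏ i ∈ Jᶜ, x i) := by
    calc _ ≤ (∏ j ∈ J, m j) * ∏ i ∈ Jᶜ, m i :=
          mul_le_mul_of_nonneg_left hcomp (prod_pos fun i _ => hm0 i).le
      _ = ((∏ j ∈ J, x j) * ∏ i ∈ Jᶜ, x i) *
          ((∏ i : Fin d with i.val < J.card, s i) * c ^ Jᶜ.card) := by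
          rw [prod_mul_prod_compl, prod_mul_prod_compl, hdet, htprod]
      _ = _ := by ring
  exact (prod_le_prod (fun i _ => (hl0 i).le) fun i _ => hlm i).trans
    (le_of_mul_le_mul_right hmJ hpos)

/-- The eigenvalues of `(X⁻¹)ᴴ * X⁻¹` are the inverses of those of `Xᴴ * X`, in opposite order. -/
lemma eig_inv_conjTranspose_mul_inv {X : Matrix (Fin d) (Fin d) ℂ} (hX : IsUnit X) :
    eig (isHermitian_conjTranspose_mul_self X⁻¹) =
      fun i => (eig (isHermitian_conjTranspose_mul_self X) (Fin.rev i))⁻¹ := by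
  set x := eig (isHermitian_conjTranspose_mul_self X) with hx
  have hx0 : ∀ i, 0 < x i :=
    eig_pos (PosDef.conjTranspose_mul_self X (mulVec_injective_iff_isUnit.mpr hX))
  have hxx : eig (isHermitian_mul_conjTranspose_self X) = x :=
    eig_eq_of_charpoly _ _ (charpoly_mul_comm _ _)
  obtain ⟨v, hv⟩ := exists_eq_spec (isHermitian_mul_conjTranspose_self X)
  rw [hxx] at hv
  refine eig_eq_of_eq_spec (v.reindex Fin.revPerm) _ (fun i j hij => ?_) ?_
  · exact inv_anti₀ (hx0 _) (eig_antitone _ (Fin.rev_le_rev.mpr hij))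
  · have h : (fun i => (x (Fin.rev i))⁻¹) = x⁻¹ ∘ (Fin.revPerm : Equiv.Perm (Fin d)).symm := rfl
    rw [h, spec_reindex, conjTranspose_nonsing_inv, ← Matrix.mul_inv_rev, hv]
    refine inv_eq_right_inv ?_
    have h1 : x * x⁻¹ = fun _ => 1 := funext fun i => mul_inv_cancel₀ (hx0 i).ne'
    rw [← spec_mul, h1, spec_const, Complex.ofReal_one, one_smul]

lemma prod_eig_conj {X C : Matrix (Fin d) (Fin d) ℂ} (hC : C.IsHermitian) :
    ∏ i, eig (isHermitian_conjTranspose_mul_mul X hC) i =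
      ∏ i, eig hC i * eig (isHermitian_conjTranspose_mul_self X) i := by
  have h := det_eq_prod_eig (isHermitian_conjTranspose_mul_mul X hC)
  have h' := det_eq_prod_eig (isHermitian_conjTranspose_mul_self X)
  rw [det_mul_right_comm, det_mul, h', det_eq_prod_eig hC] at h
  rw [prod_mul_distrib, mul_comm]
  exact_mod_cast h.symm

/-- The lower bound in the multiplicative Lidskii inequality, as the Gelfand–Naimark inequality for
`S = (X⁻¹)ᴴ * (Xᴴ * S * X) * X⁻¹`. -/
lemma prod_eig_mul_rev_le {X C : Matrix (Fin d) (Fin d) ℂ} (hX : IsUnit X) (hC : C.PosDef)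
    (J : Finset (Fin d)) :
    ∏ j ∈ J, eig hC.isHermitian j * eig (isHermitian_conjTranspose_mul_self X) (Fin.rev j) ≤
      ∏ i : Fin d with i.val < J.card,
        eig (isHermitian_conjTranspose_mul_mul X hC.isHermitian) i := by
  have hXinj : Function.Injective X.mulVec := mulVec_injective_iff_isUnit.mpr hX
  have hx0 := eig_pos (PosDef.conjTranspose_mul_self X hXinj)
  have hdet : IsUnit X.det := (isUnit_iff_isUnit_det X).mp hX
  have hD : (Xᴴ * C * X).PosDef := hC.conjTranspose_mul_mul_same hXinj
  have hXi : IsUnit X⁻¹ := isUnit_nonsing_inv_iff.mpr hX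
  have h := prod_eig_conj_le hXi hD J
  have hCeq : (X⁻¹)ᴴ * (Xᴴ * C * X) * X⁻¹ = C := by
    have h1 : (X⁻¹)ᴴ * Xᴴ = 1 := by
      rw [← conjTranspose_mul, mul_nonsing_inv X hdet, conjTranspose_one]
    rw [Matrix.mul_assoc, Matrix.mul_assoc, mul_nonsing_inv X hdet, Matrix.mul_one,
      ← Matrix.mul_assoc, h1, Matrix.one_mul]
  rw [eig_eq_of_charpoly _ hC.isHermitian (congrArg charpoly hCeq),
    eig_inv_conjTranspose_mul_inv hX, prod_inv_distrib, mul_comm, ← div_eq_mul_inv] at h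
  rw [prod_mul_distrib]
  exact (le_div_iff₀ (prod_pos fun i _ => hx0 _)).mp h

/-! ### The modulus and the trace in the equality case -/

/-- If `V * Vᴴ` is diagonalized by `v`, then so is `|Vᴴ|`, with the square roots as eigenvalues. -/
lemma abs_conjTranspose_eq_spec {V : Matrix (Fin d) (Fin d) ℂ} {x : Fin d → ℝ}
    (v : OrthonormalBasis (Fin d) ℂ (EuclideanSpace ℂ (Fin d))) (hx : ∀ i, 0 ≤ x i)
    (h : V * Vᴴ = spec v x) : CFC.abs Vᴴ = spec v fun i => Real.sqrt (x i) := by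
  refine CFC.sqrt_unique ?_ (nonneg_iff_posSemidef.mpr
    (posSemidef_spec v fun i => Real.sqrt_nonneg _))
  rw [← spec_mul, star_eq_conjTranspose, conjTranspose_conjTranspose, h]
  congr 1
  exact funext fun i => Real.mul_self_sqrt (hx i)

lemma trace_mul_eq_sum_eig_conj {S : Matrix (Fin d) (Fin d) ℂ} (hS : S.IsHermitian)
    (V : Matrix (Fin d) (Fin d) ℂ) :
    (S * (V * Vᴴ)).trace.re = ∑ i, eig (isHermitian_conjTranspose_mul_mul V hS) i := by
  rw [← Complex.ofReal_re (∑ i, _), ← trace_eq_sum_eig, Matrix.mul_assoc, trace_mul_comm Vᴴ,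
    Matrix.mul_assoc]

end Lidskii

open Matrix Lidskii in
theorem theorem5p1 {d : ℕ} (S : Matrix (Fin d) (Fin d) ℂ) (hS : S.PosSemidef) (hSu : IsUnit S)
    (γ : Fin d → ℝ) (hγ : γ ∈ posDecr d)
    (V : Matrix (Fin d) (Fin d) ℂ) (hV : IsUnit V)
    (hVγ : eig (isHermitian_conjTranspose_mul_self V) = γ) :
    LogMajorized (eig hS.isHermitian * incr γ)
        (eig (isHermitian_conjTranspose_mul_mul V hS.isHermitian)) ∧
    LogMajorized (eig (isHermitian_conjTranspose_mul_mul V hS.isHermitian))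
        (eig hS.isHermitian * γ) ∧
    eig hS.isHermitian * γ ∈ posDecr d ∧
    (eig (isHermitian_conjTranspose_mul_mul V hS.isHermitian) =
        decr (eig hS.isHermitian * incr γ) →
      ∃ v : OrthonormalBasis (Fin d) ℂ (EuclideanSpace ℂ (Fin d)),
        S = ∑ i, (eig hS.isHermitian i : ℂ) • outer (v i) (v i) ∧
        CFC.abs Vᴴ = ∑ i, (Real.sqrt (γ (Fin.rev i)) : ℂ) • outer (v i) (v i)) ∧
    (eig (isHermitian_conjTranspose_mul_mul V hS.isHermitian) = eig hS.isHermitian * γ →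
      ∃ v : OrthonormalBasis (Fin d) ℂ (EuclideanSpace ℂ (Fin d)),
        S = ∑ i, (eig hS.isHermitian i : ℂ) • outer (v i) (v i) ∧
        CFC.abs Vᴴ = ∑ i, (Real.sqrt (γ i) : ℂ) • outer (v i) (v i)) := by
  have hSpd : S.PosDef := hS.posDef_iff_isUnit.mpr hSu
  have hs0 : ∀ i, 0 < eig hS.isHermitian i := eig_pos hSpd
  have hsa := eig_antitone hS.isHermitian
  have hγ0 := hγ.1
  have hγa : Antitone γ := hVγ ▸ eig_antitone _
  have hl0 : ∀ i, 0 < eig (isHermitian_conjTranspose_mul_mul V hS.isHermitian) i :=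
    eig_pos (hSpd.conjTranspose_mul_mul_same (mulVec_injective_iff_isUnit.mpr hV))
  have hla := eig_antitone (isHermitian_conjTranspose_mul_mul V hS.isHermitian)
  have hprod := prod_eig_conj (X := V) hS.isHermitian
  have hincr := incr_of_antitone hγa
  have hlow := prod_eig_mul_rev_le hV hSpd
  have hup := prod_eig_conj_le hV hSpd
  have htr := trace_mul_eq_sum_eig_conj hS.isHermitian V
  have hVV : eig (isHermitian_mul_conjTranspose_self V) = γ :=
    hVγ ▸ eig_eq_of_charpoly _ _ (charpoly_mul_comm _ _)
  obtain ⟨u, hu⟩ := exists_eq_spec hS.isHermitian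
  obtain ⟨w, hw⟩ := exists_eq_spec (isHermitian_mul_conjTranspose_self V)
  rw [hVγ] at hprod hlow hup
  rw [hVV] at hw
  set s := eig hS.isHermitian
  set l := eig (isHermitian_conjTranspose_mul_mul V hS.isHermitian)
  have hsγa : Antitone (s * γ) := fun i j hij =>
    mul_le_mul (hsa hij) (hγa hij) (hγ0 j).le (hs0 i).le
  refine ⟨?_, ?_, ⟨fun i => mul_pos (hs0 i) (hγ0 i), (decr_of_antitone hsγa).symm⟩,
    fun h => ?_, fun h => ?_⟩
  · rw [hincr]
    refine logMajorized_of_prod_le (fun i => (mul_pos (hs0 i) (hγ0 _)).le) (fun i => (hl0 i).le)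
      hla ?_ fun J _ => hlow J
    rw [hprod]
    simp only [Pi.mul_apply, Finset.prod_mul_distrib]
    congr 1
    exact Equiv.prod_comp Fin.revPerm γ
  · refine ⟨fun i => (hl0 i).le, fun i => (mul_pos (hs0 i) (hγ0 i)).le, fun k _ hk => ?_, ?_⟩
    · rw [decr_of_antitone hla, decr_of_antitone hsγa]
      have h := hup (Finset.univ.filter fun i : Fin d => i.val < k)
      rw [card_filter_val_lt hk, mul_comm, ← Finset.prod_mul_distrib] at h
      exact h
    · rw [prod_decr, prod_decr, hprod]
      rfl
  · -- The equality case of the trace inequality, for `S` and `-V * Vᴴ`.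
    have hwneg : -(V * Vᴴ) = spec (w.reindex Fin.revPerm) (-(γ ∘ Fin.rev)) := by
      have h1 := spec_reindex w γ Fin.revPerm
      rw [spec_neg, hw, ← h1]
      rfl
    have hγneg : Antitone (-(γ ∘ Fin.rev)) := fun i j hij =>
      neg_le_neg (hγa (Fin.rev_le_rev.mpr hij))
    obtain ⟨v, hv1, hv2⟩ := exists_spec_of_trace_eq u (w.reindex Fin.revPerm) hsa hγneg (by
      rw [← hu, ← hwneg, Matrix.mul_neg, trace_neg, Complex.neg_re, htr, h, sum_decr, hincr]
      simp)
    rw [← hwneg, spec_neg, neg_inj] at hv2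
    exact ⟨v, hu.trans hv1, abs_conjTranspose_eq_spec v (fun i => (hγ0 _).le) hv2⟩
  · obtain ⟨v, hv1, hv2⟩ := exists_spec_of_trace_eq u w hsa hγa (by
      rw [← hu, ← hw, htr, h]
      simp)
    exact ⟨v, hu.trans hv1, abs_conjTranspose_eq_spec v (fun i => (hγ0 i).le) (hw.trans hv2)⟩
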